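/- Let $\omega_2$ denote the second uncountable cardinal. For a regular cardinal $\theta\ge\omega_2$ let $H(\theta)$ be the collection of all sets whose transitive closure has cardinality less than $\theta$, and let $P_{\omega_2}(H(\theta))=\{a\subseteq H(\theta) : |a|<\omega_2\}$. A club in $P_{\omega_2}(H(\theta))$ is a $\subseteq$-cofinal subset of $P_{\omega_2}(H(\theta))$ that is closed under unions of nonempty $\subseteq$-increasing sequences of length less than $\omega_2$; a collection is stationary in $P_{\omega_2}(H(\theta))$ if it meets every club. A set $N$ is guessing if the following holds for every $x\subseteq N$ for which there is $Y\in N$ with $x\subseteq Y$: if $x\cap a\in N$ for every countably infinite $a\subseteq N$ with $a\in N$, then there exists $E\in N$ such that $x=N\cap E$. Let $\mathsf{ISP}$ (that is, $\mathsf{ISP}(\omega_2)$) be the statement that for every regular cardinal $\theta\ge\omega_2$, the collection of guessing sets is stationary in $P_{\omega_2}(H(\theta))$. Then $\mathsf{ISP}$ implies the Singular Cardinal Hypothesis: for every singular cardinal $\lambda$, if $2^{\mathrm{cf}(\lambda)}<\lambda$, then $\lambda^{\mathrm{cf}(\lambda)}=\lambda^+$. -/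

import Mathlib

open Cardinal

universe u

namespace GuessingModels

/-- `H(θ)`, the collection of all sets whose transitive closure has cardinality less than `θ`,
that is, of all sets contained in some transitive set of cardinality less than `θ`. -/
def H (θ : Cardinal.{u}) : Set ZFSet.{u} :=
  {x | ∃ t : ZFSet.{u}, t.IsTransitive ∧ x ⊆ t ∧ t.card < θ}

/-- `P_κ(X) = {a ⊆ X : |a| < κ}`. -/
def P (κ : Cardinal.{u}) (X : Set ZFSet.{u}) : Set ZFSet.{u} :=
  {a | (∀ z ∈ a, z ∈ X) ∧ a.card < κ}

/-- `C` is club in `P_κ(X)`: a cofinal subset of `P_κ(X)`, closed under unions of (nonempty)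
`⊆`-increasing sequences of length less than `κ`. -/
structure IsClubIn (κ : Cardinal.{u}) (X : Set ZFSet.{u}) (C : Set ZFSet.{u}) : Prop where
  subset : C ⊆ P κ X
  cofinal : ∀ a ∈ P κ X, ∃ c ∈ C, a ⊆ c
  closed : ∀ (δ : Ordinal.{u}) (f : Set.Iio δ → ZFSet.{u}), 0 < δ → δ < κ.ord →
    (∀ ξ, f ξ ∈ C) → (∀ ξ η, ξ ≤ η → f ξ ⊆ f η) → ZFSet.iUnion f ∈ C

/-- `S` is stationary in `P_κ(X)`: it meets every club in `P_κ(X)`. -/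
def IsStationaryIn (κ : Cardinal.{u}) (X : Set ZFSet.{u}) (S : Set ZFSet.{u}) : Prop :=
  ∀ C : Set ZFSet.{u}, IsClubIn κ X C → ∃ N ∈ C, N ∈ S

/-- `x` is bounded in `N`: some `Y ∈ N` has `x ⊆ Y`. -/
def BoundedIn (x N : ZFSet.{u}) : Prop :=
  ∃ Y ∈ N, x ⊆ Y

/-- `N` is guessing: every `x ⊆ N` bounded in `N` such that `x ∩ a ∈ N` for all
`a ∈ N ∩ [N]^ω` is of the form `N ∩ E` for some `E ∈ N`. -/
def Guessing (N : ZFSet.{u}) : Prop :=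
  ∀ x : ZFSet.{u}, x ⊆ N → BoundedIn x N →
    (∀ a ∈ N, a ⊆ N → a.card = ℵ₀ → x ∩ a ∈ N) → ∃ E ∈ N, x = N ∩ E

/-- `ISP(κ)`, for a regular cardinal `κ ≥ ω₂`: for every regular `θ ≥ κ`, the guessing sets are
stationary in `P_κ(H(θ))`. -/
def ISP (κ : Cardinal.{u}) : Prop :=
  ∀ θ : Cardinal.{u}, θ.IsRegular → κ ≤ θ → IsStationaryIn κ (H θ) {N | N ∈ P κ (H θ) ∧ Guessing N}

/-- The Singular Cardinal Hypothesis: every singular cardinal `μ` with `2 ^ cf(μ) < μ`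
satisfies `μ ^ cf(μ) = μ⁺`. -/
def SCH : Prop :=
  ∀ μ : Cardinal.{u}, μ.IsSingular → 2 ^ μ.ord.cof < μ → μ ^ μ.ord.cof = Order.succ μ

end GuessingModels

universe v

namespace GuessingModels

/-! The heart is singular `c` of cofinality `ω` with `d ^ ℵ₀ < c` for all `d < c`. Injections of the
ordinals below `β < c⁺` into `c`, graded by a countable filtration of `c` into smaller pieces, give
sets `D n β` of size less than `c`. They increase with `n`, are transitive, and exhaust the ordinals
below `β`. Since `2 ^ ℵ₀ < c`, a pigeonhole argument makes their traces on any countable set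
eventually agree for all large `β`.

Take a guessing model `N` closed under the relevant choices and an ordinal `γ` above `N ∩ c⁺`.
Coherence and countable covering inside `N` give one `n` such that `D n γ ∩ N` is cofinal in `N` and
all its countable approximations lie in `N`. The set `E ∈ N` guessing it is then unbounded in `c⁺`,
and each of its countable subsets lies in some `D n β` (`exists_unbounded_covered`). Counting
countable sequences in such an unbounded set gives `c ^ ℵ₀ ≤ c⁺` (`power_aleph0_le_succ`).

The rest is cardinal arithmetic: for fixed `k`, induction on `c ≥ 2 ^ k` gives `c ^ k ≤ c⁺`. A
Silver-type argument handles uncountable cofinality at most `k`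
(`power_le_succ_of_uncountable_cof`). König's inequality is the lower bound in SCH. -/

theorem H_of_mem {θ : Cardinal.{u}} {x y : ZFSet.{u}} (hx : x ∈ H θ) (hy : y ∈ x) : y ∈ H θ := by
  obtain ⟨t, ht, hxt, hc⟩ := hx
  exact ⟨t, ht, ht.subset_of_mem (hxt hy), hc⟩

theorem H_of_subset {θ : Cardinal.{u}} {x y : ZFSet.{u}} (hx : x ∈ H θ) (hy : y ⊆ x) : y ∈ H θ := by
  obtain ⟨t, ht, hxt, hc⟩ := hx
  exact ⟨t, ht, fun _ h => hxt (hy h), hc⟩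

theorem H_of_forall_mem_subset {θ : Cardinal.{u}} {x y : ZFSet.{u}} (hx : x ∈ H θ)
    (hy : ∀ z ∈ y, ∃ w ∈ x, z ∈ w) : y ∈ H θ := by
  obtain ⟨t, ht, hxt, hc⟩ := hx
  refine ⟨t, ht, fun z hz => ?_, hc⟩
  obtain ⟨w, hw, hzw⟩ := hy z hz
  exact ht.subset_of_mem (hxt hw) hzw

theorem card_lt_aleph_two_iff {x : ZFSet.{u}} : x.card < ℵ_ 2 ↔ x.card ≤ ℵ_ 1 := by
  rw [← Order.lt_succ_iff, succ_aleph]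
  norm_num

theorem card_iUnion_le {ι : Type v} [Small.{u} ι] {f : ι → ZFSet.{u}} {c : Cardinal.{u}}
    (hc : ℵ₀ ≤ c) (hι : lift.{u} #ι ≤ lift.{v} c) (hf : ∀ i, (f i).card ≤ c) :
    (ZFSet.iUnion f).card ≤ c := by
  have h : (ZFSet.iUnion fun i : Shrink.{u} ι => f ((equivShrink ι).symm i)).card ≤
      Cardinal.sum fun i : Shrink.{u} ι => (f ((equivShrink ι).symm i)).card := by
    simpa using ZFSet.lift_card_iUnion_le_sum_card
      (f := fun i : Shrink.{u} ι => f ((equivShrink ι).symm i))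
  have h' : ZFSet.iUnion f = ZFSet.iUnion fun i : Shrink.{u} ι => f ((equivShrink ι).symm i) := by
    ext z
    simp only [ZFSet.mem_iUnion]
    exact ⟨fun ⟨i, hi⟩ => ⟨equivShrink ι i, by simpa using hi⟩, fun ⟨i, hi⟩ => ⟨_, hi⟩⟩
  rw [h']
  refine h.trans ((Cardinal.sum_le_sum _ (fun _ => c) fun i => hf _).trans ?_)
  rw [Cardinal.sum_const']
  refine (mul_le_mul_left ?_ c).trans (mul_eq_self hc).le
  rw [← lift_mk_shrink', lift_le] at hι
  exact hι

/-! ### Clubs of closed sets -/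

/-- One step of the closure of a set under a set-valued binary operation, inside `X`. -/
noncomputable def closureStep (X : Set ZFSet.{u}) (F : ZFSet.{u} → ZFSet.{u} → ZFSet.{u})
    (a : ZFSet.{u}) : ZFSet.{u} :=
  a ∪ (ZFSet.iUnion fun p : a × a => F p.1 p.2).sep (· ∈ X)

theorem mem_closureStep {X : Set ZFSet.{u}} {F : ZFSet.{u} → ZFSet.{u} → ZFSet.{u}}
    {a z : ZFSet.{u}} :
    z ∈ closureStep X F a ↔ z ∈ a ∨ (∃ x ∈ a, ∃ y ∈ a, z ∈ F x y) ∧ z ∈ X := by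
  simp [closureStep]

theorem closureStep_mem_P {X : Set ZFSet.{u}} {F : ZFSet.{u} → ZFSet.{u} → ZFSet.{u}}
    (hF : ∀ x y, (F x y).card ≤ ℵ_ 1) {a : ZFSet.{u}} (ha : a ∈ P (ℵ_ 2) X) :
    closureStep X F a ∈ P (ℵ_ 2) X := by
  refine ⟨fun z hz => ?_, ?_⟩
  · rcases mem_closureStep.1 hz with h | h
    exacts [ha.1 z h, h.2]
  · have h1 := card_lt_aleph_two_iff.1 ha.2
    have h2 : (ZFSet.iUnion fun p : a × a =>
        F p.1 p.2).card ≤ ℵ_ 1 := by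
      refine card_iUnion_le (aleph0_le_aleph 1) ?_ fun p => hF _ _
      rw [mk_prod, ZFSet.cardinalMk_coe_sort]
      simp only [lift_lift, lift_mul]
      have h3 : lift.{u+1} a.card ≤ lift.{u+1} (ℵ_ 1 : Cardinal.{u}) := lift_le.2 h1
      calc _ ≤ lift.{u+1} (ℵ_ 1 : Cardinal.{u}) * lift.{u+1} (ℵ_ 1 : Cardinal.{u}) := by
            gcongr
        _ = _ := by rw [← lift_mul, mul_eq_self (aleph0_le_aleph 1)]
    rw [card_lt_aleph_two_iff]
    refine ZFSet.card_union_le.trans ?_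
    refine (add_le_add h1 ((ZFSet.card_mono ZFSet.sep_subset).trans h2)).trans ?_
    exact (add_eq_self (aleph0_le_aleph 1)).le

/-- The sets of size at most `ℵ₁` that contain `c` and are closed under `F` form a club. -/
theorem isClubIn_closed {X : Set ZFSet.{u}} {F : ZFSet.{u} → ZFSet.{u} → ZFSet.{u}}
    (hF : ∀ x y, (F x y).card ≤ ℵ_ 1) {c : ZFSet.{u}} (hc : c ∈ P (ℵ_ 2) X) :
    IsClubIn (ℵ_ 2) X {N | N ∈ P (ℵ_ 2) X ∧ c ⊆ N ∧
      ∀ x ∈ N, ∀ y ∈ N, ∀ z ∈ F x y, z ∈ X → z ∈ N} where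
  subset := fun _ h => h.1
  cofinal := by
    intro a ha
    have hac : a ∪ c ∈ P (ℵ_ 2) X := by
      refine ⟨fun z hz => ?_, ?_⟩
      · rcases ZFSet.mem_union.1 hz with h | h
        exacts [ha.1 z h, hc.1 z h]
      · rw [card_lt_aleph_two_iff]
        exact ZFSet.card_union_le.trans ((add_le_add (card_lt_aleph_two_iff.1 ha.2)
          (card_lt_aleph_two_iff.1 hc.2)).trans (add_eq_self (aleph0_le_aleph 1)).le)
    let s : ℕ → ZFSet.{u} := fun n => (closureStep X F)^[n] (a ∪ c)
    have hs : ∀ n, s (n + 1) = closureStep X F (s n) := fun n =>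
      Function.iterate_succ_apply' _ _ _
    have hsP : ∀ n, s n ∈ P (ℵ_ 2) X := by
      intro n
      induction n with
      | zero => exact hac
      | succ n ih => rw [hs]; exact closureStep_mem_P hF ih
    have hmono : ∀ n m, n ≤ m → s n ⊆ s m := by
      intro n m h
      induction h with
      | refl => exact fun _ h => h
      | step _ ih => intro z hz; rw [hs]; exact mem_closureStep.2 (Or.inl (ih hz))
    refine ⟨ZFSet.iUnion s, ⟨⟨?_, ?_⟩, ?_, ?_⟩, ?_⟩
    · intro z hz
      obtain ⟨n, hn⟩ := ZFSet.mem_iUnion.1 hz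
      exact (hsP n).1 z hn
    · rw [card_lt_aleph_two_iff]
      refine card_iUnion_le (aleph0_le_aleph 1) ?_ fun n => card_lt_aleph_two_iff.1 (hsP n).2
      simp
    · intro z hz
      exact ZFSet.mem_iUnion.2 ⟨0, ZFSet.mem_union.2 (Or.inr hz)⟩
    · intro x hx y hy z hz hzX
      obtain ⟨n, hn⟩ := ZFSet.mem_iUnion.1 hx
      obtain ⟨m, hm⟩ := ZFSet.mem_iUnion.1 hy
      refine ZFSet.mem_iUnion.2 ⟨max n m + 1, ?_⟩
      change z ∈ s (max n m + 1)
      rw [hs]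
      exact mem_closureStep.2 (Or.inr ⟨⟨x, hmono _ _ (le_max_left _ _) hn, y,
        hmono _ _ (le_max_right _ _) hm, hz⟩, hzX⟩)
    · intro z hz
      exact ZFSet.mem_iUnion.2 ⟨0, ZFSet.mem_union.2 (Or.inl hz)⟩
  closed := by
    intro δ f hδ hδ2 hf hmono
    refine ⟨⟨?_, ?_⟩, ?_, ?_⟩
    · intro z hz
      obtain ⟨n, hn⟩ := ZFSet.mem_iUnion.1 hz
      exact (hf n).1.1 z hn
    · rw [card_lt_aleph_two_iff]
      refine card_iUnion_le (aleph0_le_aleph 1) ?_ fun n => card_lt_aleph_two_iff.1 (hf n).1.2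
      rw [mk_Iio_ordinal]
      simp only [lift_lift]
      refine lift_le.2 ?_
      rw [lt_ord] at hδ2
      rw [← Order.lt_succ_iff, succ_aleph]
      norm_num
      exact hδ2
    · intro z hz
      exact ZFSet.mem_iUnion.2 ⟨⟨0, hδ⟩, (hf _).2.1 hz⟩
    · intro x hx y hy z hz hzX
      obtain ⟨n, hn⟩ := ZFSet.mem_iUnion.1 hx
      obtain ⟨m, hm⟩ := ZFSet.mem_iUnion.1 hy
      refine ZFSet.mem_iUnion.2 ⟨max n m, ?_⟩
      exact (hf _).2.2 x (hmono _ _ (le_max_left _ _) hn) y (hmono _ _ (le_max_right _ _) hm) z hz hzX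

/-! ### Guessing models with closure properties -/

theorem exists_subset_card_eq {x : ZFSet.{u}} {c : Cardinal.{u}} (h : c ≤ x.card) :
    ∃ y ⊆ x, y.card = c := by
  have h' : lift.{u + 1} c ≤ #(x : Set ZFSet.{u}) := by
    have : #(x : Set ZFSet.{u}) = lift.{u + 1, u} x.card := ZFSet.cardinalMk_coe_sort
    rw [this]
    exact lift_le.2 h
  obtain ⟨s, hs, hc⟩ := le_mk_iff_exists_subset.1 h'
  refine ⟨x.sep (· ∈ s), ZFSet.sep_subset, ?_⟩
  rw [← lift_inj.{u, u + 1}, ← ZFSet.cardinalMk_coe_sort, ← hc]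
  have : ((x.sep (· ∈ s) : ZFSet.{u}) : Set ZFSet.{u}) = s := by
    ext z
    simpa using fun h => hs h
  change #((x.sep (· ∈ s) : ZFSet.{u}) : Set ZFSet.{u}) = _
  rw [this]

/-- Stands in for elementarity. Closing `N` under `E ↦ e` puts countable elements inside `N`, and
puts `ℵ₁` many members of every uncountable `E ∈ N` into `N`, so that `E` is countable once `N ∩ E`
is. -/
theorem exists_core (E : ZFSet.{u}) :
    ∃ e ⊆ E, e.card ≤ ℵ_ 1 ∧ (E.card ≤ ℵ_ 1 → e = E) ∧ (ℵ_ 1 ≤ E.card → ℵ_ 1 ≤ e.card) := by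
  rcases le_total E.card (ℵ_ 1) with h | h
  · exact ⟨E, fun _ h => h, h, fun _ => rfl, id⟩
  · obtain ⟨e, he, hc⟩ := exists_subset_card_eq h
    by_cases h' : E.card ≤ ℵ_ 1
    · exact ⟨E, fun _ h => h, h', fun _ => rfl, id⟩
    · exact ⟨e, he, hc.le, fun h'' => absurd h'' h', fun _ => hc.ge⟩

/-- The union of the finite elements of `x`. -/
noncomputable def finiteUnion (x : ZFSet.{u}) : ZFSet.{u} :=
  ZFSet.sUnion (x.sep fun z => z.card < ℵ₀)

theorem mem_finiteUnion {x z : ZFSet.{u}} : z ∈ finiteUnion x ↔ ∃ y ∈ x, y.card < ℵ₀ ∧ z ∈ y := by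
  simp [finiteUnion, and_assoc]

theorem card_sUnion_le_aleph0 {x : ZFSet.{u}} (hx : x.card ≤ ℵ₀) (h : ∀ y ∈ x, y.card ≤ ℵ₀) :
    (ZFSet.sUnion x).card ≤ ℵ₀ := by
  have : ZFSet.sUnion x = ZFSet.iUnion fun y : x => (y : ZFSet.{u}) := by
    ext z
    simp
  rw [this]
  refine card_iUnion_le le_rfl ?_ fun y => h _ y.2
  rw [ZFSet.cardinalMk_coe_sort]
  simpa using hx

theorem card_finiteUnion_le {x : ZFSet.{u}} (hx : x.card ≤ ℵ₀) : (finiteUnion x).card ≤ ℵ₀ :=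
  card_sUnion_le_aleph0 ((ZFSet.card_mono ZFSet.sep_subset).trans hx) fun _ hy =>
    (ZFSet.mem_sep.1 hy).2.le

theorem card_range_le_aleph0 (f : ℕ → ZFSet.{u}) : (ZFSet.range f).card ≤ ℵ₀ := by
  have := ZFSet.lift_card_range_le (f := f)
  simpa using this

/-- The closure properties of a sufficiently elementary guessing model relative to a set `V`
of parameters. -/
structure IsGuessingModel (V : ZFSet.{u}) (G : ZFSet.{u} → ZFSet.{u}) (N : ZFSet.{u}) : Prop where
  guessing : Guessing N
  card_le : N.card ≤ ℵ_ 1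
  empty_mem : ∅ ∈ N
  insert_mem : ∀ x ∈ N, ∀ y ∈ N, insert x y ⊆ V → insert x y ∈ N
  inter_mem : ∀ x ∈ N, ∀ y ∈ N, x ∩ y ∈ N
  subset_of_countable : ∀ E ∈ N, E.card ≤ ℵ₀ → E ⊆ N
  countable_of_inter : ∀ E ∈ N, (N ∩ E).card ≤ ℵ₀ → E.card ≤ ℵ₀
  finiteUnion_mem : ∀ x ∈ N, finiteUnion x ∈ N
  map_mem : ∀ x ∈ N, ∀ y ∈ G x, y ⊆ V → y ∈ N

theorem exists_isGuessingModel (h : ISP.{u} (ℵ_ 2)) {V : ZFSet.{u}} (hV : V.IsTransitive)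
    (c : ZFSet.{u}) (hc : c.card ≤ ℵ_ 1) (hcV : ∀ z ∈ c, z ⊆ V) (G : ZFSet.{u} → ZFSet.{u})
    (hG : ∀ x, (G x).card ≤ ℵ_ 1) : ∃ N, IsGuessingModel V G N ∧ c ⊆ N := by
  choose e he hec heq hge using exists_core.{u}
  let F : ZFSet.{u} → ZFSet.{u} → ZFSet.{u} := fun x y =>
    {insert x y} ∪ ({x ∩ y} ∪ (e x ∪ ({finiteUnion x} ∪ G x)))
  have h1 : (1 : Cardinal.{u}) ≤ ℵ_ 1 := one_le_aleph0.trans (aleph0_le_aleph 1)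
  have hadd {x y : ZFSet.{u}} (hx : x.card ≤ ℵ_ 1) (hy : y.card ≤ ℵ_ 1) : (x ∪ y).card ≤ ℵ_ 1 :=
    ZFSet.card_union_le.trans ((add_le_add hx hy).trans (add_eq_self (aleph0_le_aleph 1)).le)
  have hF : ∀ x y, (F x y).card ≤ ℵ_ 1 := fun x y =>
    hadd (by simpa using h1) (hadd (by simpa using h1) (hadd (hec x)
      (hadd (by simpa using h1) (hG x))))
  -- Large enough that every subset of the transitive set `V` belongs to `H θ`.
  let θ : Cardinal.{u} := Order.succ (max (ℵ_ 2) V.card)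
  have hθ : θ.IsRegular := isRegular_succ ((aleph0_le_aleph 2).trans (le_max_left _ _))
  have h2θ : ℵ_ 2 ≤ θ := (le_max_left _ _).trans (Order.le_succ _)
  have hVH : ∀ z, z ⊆ V → z ∈ H θ := fun z hz =>
    ⟨V, hV, hz, Order.lt_succ_iff.2 (le_max_right _ _)⟩
  have hcP : insert ∅ c ∈ P (ℵ_ 2) (H θ) := by
    refine ⟨fun z hz => hVH z ?_, ?_⟩
    · rcases ZFSet.mem_insert_iff.1 hz with rfl | hz
      exacts [ZFSet.empty_subset _, hcV z hz]
    · rw [card_lt_aleph_two_iff]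
      refine ZFSet.card_insert_le.trans ((add_le_add hc h1).trans ?_)
      exact (add_eq_self (aleph0_le_aleph 1)).le
  obtain ⟨N, ⟨hNP, hcN, hcl⟩, -, hg⟩ := h θ hθ h2θ _ (isClubIn_closed hF hcP)
  have heN : ∀ E ∈ N, e E ⊆ N := fun E hE z hz =>
    hcl E hE E hE z (by simp [F, hz]) (H_of_mem (hNP.1 E hE) (he E hz))
  refine ⟨N, ⟨hg, card_lt_aleph_two_iff.1 hNP.2, hcN (ZFSet.mem_insert _ _), ?_, ?_, ?_, ?_, ?_, ?_⟩,
    fun z hz => hcN (ZFSet.mem_insert_of_mem _ hz)⟩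
  · exact fun x hx y hy hxy => hcl x hx y hy _ (by simp [F]) (hVH _ hxy)
  · exact fun x hx y hy => hcl x hx y hy _ (by simp [F])
      (H_of_subset (hNP.1 x hx) fun z hz => (ZFSet.mem_inter.1 hz).1)
  · intro E hE hEc
    rw [← heq E (hEc.trans (aleph0_le_aleph 1))]
    exact heN E hE
  · intro E hE hEc
    by_contra hlt
    rw [not_le, ← Order.succ_le_iff, ← aleph_zero, succ_aleph] at hlt
    have h3 := hge E (by simpa using hlt)
    have h4 : e E ⊆ N ∩ E := fun z hz => ZFSet.mem_inter.2 ⟨heN E hE hz, he E hz⟩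
    have h5 := h3.trans ((ZFSet.card_mono h4).trans hEc)
    exact absurd aleph0_lt_aleph_one h5.not_gt
  · refine fun x hx => hcl x hx x hx _ (by simp [F]) (H_of_forall_mem_subset (hNP.1 x hx) ?_)
    intro z hz
    obtain ⟨y, hy, -, hzy⟩ := mem_finiteUnion.1 hz
    exact ⟨y, hy, hzy⟩
  · exact fun x hx y hy hyV => hcl x hx x hx _ (by simp [F, hy]) (hVH _ hyV)

theorem mk_coe_set (x : ZFSet.{u}) : #(x : Set ZFSet.{u}) = lift.{u + 1, u} x.card :=
  ZFSet.cardinalMk_coe_sort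

theorem finite_of_card_lt {x : ZFSet.{u}} (h : x.card < ℵ₀) : (x : Set ZFSet.{u}).Finite := by
  rw [← lt_aleph0_iff_set_finite, mk_coe_set]
  simpa using h

theorem card_lt_of_finite {x : ZFSet.{u}} (h : (x : Set ZFSet.{u}).Finite) : x.card < ℵ₀ := by
  rw [← lt_aleph0_iff_set_finite, mk_coe_set] at h
  simpa using h

namespace IsGuessingModel

variable {V N : ZFSet.{u}} {G : ZFSet.{u} → ZFSet.{u}}

theorem finite_subset_mem (hN : IsGuessingModel V G N) {x : ZFSet.{u}} (hx : x.card < ℵ₀)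
    (hxN : x ⊆ N) (hxV : x ⊆ V) : x ∈ N := by
  have key : ∀ s : Set ZFSet.{u}, s.Finite → ∀ x : ZFSet.{u}, (x : Set ZFSet.{u}) = s →
      x ⊆ N → x ⊆ V → x ∈ N := by
    intro s hs
    induction s, hs using Set.Finite.induction_on with
    | empty =>
      intro x hx _ _
      have : x = ∅ := SetLike.coe_injective (by simpa using hx)
      exact this ▸ hN.empty_mem
    | @insert a s _ _ ih =>
      intro x hx hxN hxV
      have hmem : ∀ z, z ∈ x ↔ z = a ∨ z ∈ s := fun z => by
        rw [← SetLike.mem_coe, hx, Set.mem_insert_iff]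
      have hy : ((x.sep (· ∈ s) : ZFSet.{u}) : Set ZFSet.{u}) = s := by
        ext z
        simp only [ZFSet.coe_sep, Set.mem_ofPred_eq, hmem]
        tauto
      have h1 := ih _ hy (fun z hz => hxN (ZFSet.sep_subset hz))
        (fun z hz => hxV (ZFSet.sep_subset hz))
      have h2 : x = insert a (x.sep (· ∈ s)) := by
        ext z
        simp only [ZFSet.mem_insert_iff, ZFSet.mem_sep, hmem]
        tauto
      rw [h2]
      refine hN.insert_mem a (hxN ((hmem a).2 (Or.inl rfl))) _ h1 ?_
      rw [← h2]
      exact hxV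
  exact key _ (finite_of_card_lt hx) x rfl hxN hxV

/-- Guessing models are internally unbounded: countably many elements of the model that lie in a
common element of the model are covered by a countable element of the model. -/
theorem exists_countable_cover (hN : IsGuessingModel V G N) {X : ZFSet.{u}} (hX : X.powerset ∈ N)
    (hXV : X.powerset ⊆ V) (hXV' : X ⊆ V) (b : ℕ → ZFSet.{u}) (hbN : ∀ n, b n ∈ N)
    (hbX : ∀ n, b n ∈ X) : ∃ c ∈ N, c.card ≤ ℵ₀ ∧ ∀ n, b n ∈ c := by
  -- The finite initial segments `s n = {b 0, …, b (n - 1)}` all lie in `N`; the set to be guessed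
  -- is the set of these segments.
  let s : ℕ → ZFSet.{u} := fun n => Nat.rec ∅ (fun n a => insert (b n) a) n
  have hs : ∀ n, s (n + 1) = insert (b n) (s n) := fun n => rfl
  have hs0 : s 0 = ∅ := rfl
  clear_value s
  have hsfin : ∀ n, (s n).card < ℵ₀ := by
    intro n
    induction n with
    | zero => simpa [hs0] using aleph0_pos
    | succ n ih =>
      rw [hs]
      exact ZFSet.card_insert_le.trans_lt (add_lt_aleph0 ih one_lt_aleph0)
  have hmono : ∀ n m, n ≤ m → s n ⊆ s m := by
    intro n m h
    induction h with
    | refl => exact fun _ h => h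
    | step _ ih => intro z hz; rw [hs]; exact ZFSet.mem_insert_of_mem _ (ih hz)
  have hbs : ∀ n m, n < m → b n ∈ s m := fun n m h => hmono (n + 1) m h
    (by rw [hs]; exact ZFSet.mem_insert _ _)
  have hsub : ∀ n, ∀ z ∈ s n, ∃ i, z = b i := by
    intro n
    induction n with
    | zero => intro z hz; simp [hs0] at hz
    | succ n ih =>
      intro z hz
      rw [hs, ZFSet.mem_insert_iff] at hz
      rcases hz with rfl | hz
      exacts [⟨n, rfl⟩, ih z hz]
  have hsX : ∀ n, s n ⊆ X := fun n z hz => by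
    obtain ⟨i, rfl⟩ := hsub n z hz
    exact hbX i
  have hsN : ∀ n, s n ∈ N := fun n => hN.finite_subset_mem (hsfin n)
    (fun z hz => by obtain ⟨i, rfl⟩ := hsub n z hz; exact hbN i) fun z hz => hXV' (hsX n hz)
  have hxc : (ZFSet.range s).card ≤ ℵ₀ := card_range_le_aleph0 s
  -- If every countable `a ∈ N` contains only finitely many segments, all approximations are finite,
  -- hence in `N`. The guess `E` has countable trace on `N`, so it is countable and its finite
  -- members cover the sequence.
  by_cases hfin : ∀ a ∈ N, a ⊆ N → a.card = ℵ₀ → (ZFSet.range s ∩ a).card < ℵ₀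
  · obtain ⟨E, hE, hxE⟩ := hN.guessing (ZFSet.range s)
      (fun z hz => by obtain ⟨n, rfl⟩ := ZFSet.mem_range.1 hz; exact hsN n)
      ⟨X.powerset, hX, fun z hz => by
        obtain ⟨n, rfl⟩ := ZFSet.mem_range.1 hz; exact ZFSet.mem_powerset.2 (hsX n)⟩
      (fun a ha haN hac => hN.finite_subset_mem (hfin a ha haN hac)
        (fun z hz => haN (ZFSet.mem_inter.1 hz).2) fun z hz => by
          obtain ⟨n, rfl⟩ := ZFSet.mem_range.1 (ZFSet.mem_inter.1 hz).1
          exact hXV (ZFSet.mem_powerset.2 (hsX n)))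
    have hEc := hN.countable_of_inter E hE (by rwa [← hxE])
    refine ⟨finiteUnion E, hN.finiteUnion_mem E hE, card_finiteUnion_le hEc, fun n => ?_⟩
    refine mem_finiteUnion.2 ⟨s (n + 1), ?_, hsfin (n + 1), hbs n (n + 1) (Nat.lt_succ_self n)⟩
    have : s (n + 1) ∈ N ∩ E := by
      rw [← hxE]
      exact ZFSet.mem_range.2 ⟨n + 1, rfl⟩
    exact (ZFSet.mem_inter.1 this).2
  -- Otherwise a countable `a ∈ N` contains infinitely many segments, and the union of its finite
  -- members already covers everything.
  · push Not at hfin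
    obtain ⟨a, ha, -, hac, hinf⟩ := hfin
    refine ⟨finiteUnion a, hN.finiteUnion_mem a ha, card_finiteUnion_le hac.le, fun n => ?_⟩
    have hex : ∃ m, n < m ∧ s m ∈ a := by
      by_contra hno
      push Not at hno
      have h1 : ((ZFSet.range s ∩ a : ZFSet.{u}) : Set ZFSet.{u}) ⊆ s '' Set.Iic n := by
        intro z hz
        obtain ⟨h2, h3⟩ := ZFSet.mem_inter.1 hz
        obtain ⟨m, rfl⟩ := ZFSet.mem_range.1 h2
        exact ⟨m, not_lt.1 fun h => hno m h h3, rfl⟩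
      have h2 := ((Set.finite_Iic n).image s).subset h1
      exact absurd hinf (not_le.2 (card_lt_of_finite h2))
    obtain ⟨m, hnm, hm⟩ := hex
    exact mem_finiteUnion.2 ⟨s m, hm, hsfin m, hbs n m hnm⟩

end IsGuessingModel

/-! ### Coding a well-order by sets -/

/-- A code for the elements of a well-order by sets. -/
noncomputable def code {W : Type u} [LinearOrder W] [WellFoundedLT W] (w : W) : ZFSet.{u} :=
  (Ordinal.typein (α := W) (· < ·) w).toZFSet

section

variable {W : Type u} [LinearOrder W] [WellFoundedLT W]

theorem code_injective : Function.Injective (code : W → ZFSet.{u}) := fun _ _ h =>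
  Ordinal.typein_injective (α := W) (· < ·) (Ordinal.toZFSet_injective h)

/-- The code of a set of elements of a well-order. -/
noncomputable def encode (A : Set W) : ZFSet.{u} := ZFSet.range fun w : A => code w.1

/-- The set of elements of a well-order whose codes belong to a given set. -/
def decode (W : Type u) [LinearOrder W] [WellFoundedLT W] (a : ZFSet.{u}) : Set W :=
  {w | code w ∈ a}

theorem mem_encode {A : Set W} {z : ZFSet.{u}} : z ∈ encode A ↔ ∃ w ∈ A, code w = z := by
  simp [encode]

theorem code_mem_encode {A : Set W} {w : W} : code w ∈ encode A ↔ w ∈ A := by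
  rw [mem_encode]
  exact ⟨fun ⟨v, hv, h⟩ => code_injective h ▸ hv, fun h => ⟨w, h, rfl⟩⟩

@[simp] theorem mem_decode {a : ZFSet.{u}} {w : W} : w ∈ decode W a ↔ code w ∈ a := Iff.rfl

theorem encode_mono {A B : Set W} (h : A ⊆ B) : encode A ⊆ encode B := fun _ hz => by
  obtain ⟨w, hw, rfl⟩ := mem_encode.1 hz
  exact code_mem_encode.2 (h hw)

theorem encode_subset_univ (A : Set W) : encode A ⊆ encode (Set.univ : Set W) :=
  encode_mono (Set.subset_univ A)

theorem mk_decode_le (a : ZFSet.{u}) : #(decode W a) ≤ a.card := by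
  have h : lift.{u + 1} #(decode W a) ≤ lift.{u} #(a : Set ZFSet.{u}) :=
    lift_mk_le'.2 ⟨⟨fun w => ⟨code w.1, w.2⟩, fun v w h =>
      Subtype.ext (code_injective (congrArg Subtype.val h))⟩⟩
  rw [mk_coe_set] at h
  simpa using h

theorem card_encode_le (A : Set W) : (encode A).card ≤ #A := by
  have := ZFSet.lift_card_range_le (f := fun w : A => (code w.1 : ZFSet.{u}))
  simpa [encode] using this

end

/-- The union of the countable elements of `x` that are subsets of `B`. -/
noncomputable def countableUnion (B x : ZFSet.{u}) : ZFSet.{u} :=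
  ZFSet.sUnion (x.sep fun z => z ⊆ B ∧ z.card ≤ ℵ₀)

theorem countableUnion_subset (B x : ZFSet.{u}) : countableUnion B x ⊆ B := fun z hz => by
  obtain ⟨y, hy, hzy⟩ := ZFSet.mem_sUnion.1 hz
  exact (ZFSet.mem_sep.1 hy).2.1 hzy

theorem card_countableUnion_le (B : ZFSet.{u}) {x : ZFSet.{u}} (hx : x.card ≤ ℵ₀) :
    (countableUnion B x).card ≤ ℵ₀ :=
  card_sUnion_le_aleph0 ((ZFSet.card_mono ZFSet.sep_subset).trans hx) fun _ hy =>
    (ZFSet.mem_sep.1 hy).2.2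

theorem subset_countableUnion {B x y : ZFSet.{u}} (hy : y ∈ x) (hyB : y ⊆ B) (hyc : y.card ≤ ℵ₀) :
    y ⊆ countableUnion B x := fun _ hz =>
  ZFSet.mem_sUnion.2 ⟨y, ZFSet.mem_sep.2 ⟨hy, hyB, hyc⟩, hz⟩

/-! ### Guessing along a coherent matrix -/

/-- Under `ISP(ω₂)`, every matrix `D` of subsets of a well-order that is strongly coherent on
countable sets covers all countable subsets of some unbounded set. -/
theorem exists_unbounded_covered (h : ISP.{u} (ℵ_ 2)) {W : Type u} [LinearOrder W]
    [WellFoundedLT W] (hbdd : ∀ A : Set W, #A ≤ ℵ_ 1 → ∃ w, ∀ a ∈ A, a < w)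
    (D : ℕ → W → Set W) (hmono : ∀ n m β, n ≤ m → D n β ⊆ D m β)
    (hunion : ∀ α β, α < β → ∃ n, α ∈ D n β)
    (hcoh : ∀ A : Set W, #A ≤ ℵ₀ → ∃ γ, ∀ β, γ ≤ β → ∃ k, ∀ m, k ≤ m → D m β ∩ A = D m γ ∩ A) :
    ∃ (n : ℕ) (A : Set W), (∀ w, ∃ a ∈ A, w ≤ a) ∧ ∀ X ⊆ A, #X ≤ ℵ₀ → ∃ β, X ⊆ D n β := by
  by_contra hno
  push Not at hno
  have : Nonempty W := (hbdd ∅ (by simp)).nonempty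
  have hub : ∀ A : Set W, ∃ w, (∃ v, ∀ a ∈ A, a < v) → ∀ a ∈ A, a < w := fun A => by
    by_cases hA : ∃ v, ∀ a ∈ A, a < v
    · exact ⟨hA.choose, fun _ => hA.choose_spec⟩
    · exact ⟨Classical.arbitrary W, fun h => absurd h hA⟩
  choose ub hub using hub
  have hγ : ∀ A : Set W, ∃ γ, #A ≤ ℵ₀ →
      ∀ β, γ ≤ β → ∃ k, ∀ m, k ≤ m → D m β ∩ A = D m γ ∩ A := fun A => by
    by_cases hA : #A ≤ ℵ₀
    · exact ⟨(hcoh A hA).choose, fun _ => (hcoh A hA).choose_spec⟩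
    · exact ⟨Classical.arbitrary W, fun h => absurd h hA⟩
  choose g hg using hγ
  have hX : ∀ (n : ℕ) (A : Set W), ∃ X : Set W, #X ≤ ℵ₀ ∧
      ((∀ w, ∃ a ∈ A, w ≤ a) → X ⊆ A ∧ ∀ β, ¬ X ⊆ D n β) := fun n A => by
    by_cases hA : ∀ w, ∃ a ∈ A, w ≤ a
    · obtain ⟨X, h1, h2, h3⟩ := hno n A hA
      exact ⟨X, h2, fun _ => ⟨h1, h3⟩⟩
    · exact ⟨∅, by simp, fun h => absurd h hA⟩
  choose bad hbadc hbad using hX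
  let B : ZFSet.{u} := encode (Set.univ : Set W)
  -- Contains both codes of points and codes of subsets, since countable covering is applied to
  -- sequences of each kind.
  let X : ZFSet.{u} := B ∪ B.powerset
  obtain ⟨o, ho⟩ := ZFSet.exists_mem_vonNeumann X.powerset
  let V := ZFSet.vonNeumann (o + 1)
  have hVt : V.IsTransitive := ZFSet.isTransitive_vonNeumann _
  have hPV : X.powerset ∈ V := ZFSet.vonNeumann_subset_of_le (by simp) ho
  have hPV' : X.powerset ⊆ V := hVt.subset_of_mem hPV
  have hXV : X ∈ V := hPV' (ZFSet.mem_powerset.2 fun _ h => h)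
  have hXV' : X ⊆ V := hVt.subset_of_mem hXV
  have hBV : B ⊆ V := fun z hz => hXV' (ZFSet.mem_union.2 (Or.inl hz))
  have hcodeV : ∀ w : W, code w ⊆ V := fun w =>
    hVt.subset_of_mem (hBV (code_mem_encode.2 (Set.mem_univ w)))
  have hBX : ∀ z, z ⊆ B → z ∈ X := fun z hz =>
    ZFSet.mem_union.2 (Or.inr (ZFSet.mem_powerset.2 hz))
  let G : ZFSet.{u} → ZFSet.{u} := fun x =>
    {countableUnion B x} ∪ ({code (g (decode W x))} ∪ ({code (ub (decode W x))} ∪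
      (ZFSet.range (fun m : ℕ => encode (D m (g (decode W x))) ∩ x) ∪
        ZFSet.range fun m : ℕ => encode (bad m (decode W x)))))
  have h1 : (1 : Cardinal.{u}) ≤ ℵ_ 1 := one_le_aleph0.trans (aleph0_le_aleph 1)
  have hadd {x y : ZFSet.{u}} (hx : x.card ≤ ℵ_ 1) (hy : y.card ≤ ℵ_ 1) : (x ∪ y).card ≤ ℵ_ 1 :=
    ZFSet.card_union_le.trans ((add_le_add hx hy).trans (add_eq_self (aleph0_le_aleph 1)).le)
  have hG : ∀ x, (G x).card ≤ ℵ_ 1 := fun x =>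
    hadd (by simpa using h1) (hadd (by simpa using h1) (hadd (by simpa using h1)
      (hadd ((card_range_le_aleph0 _).trans (aleph0_le_aleph 1))
        ((card_range_le_aleph0 _).trans (aleph0_le_aleph 1)))))
  have h11 : (1 : Cardinal.{u}) + 1 ≤ ℵ_ 1 :=
    (add_le_add h1 h1).trans (add_eq_self (aleph0_le_aleph 1)).le
  obtain ⟨N, hN, hcN⟩ := exists_isGuessingModel h hVt ({B, X.powerset} : ZFSet.{u})
    (ZFSet.card_insert_le.trans (by simpa using h11))
    (by
      intro z hz
      rcases ZFSet.mem_pair.1 hz with rfl | rfl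
      exacts [hBV, hPV']) G hG
  have hBN : B ∈ N := hcN (by simp)
  have hPN : X.powerset ∈ N := hcN (by simp)
  have hU : ∀ x ∈ N, countableUnion B x ∈ N := fun x hx => hN.map_mem x hx _ (by simp [G])
    fun z hz => hBV (countableUnion_subset B x hz)
  have hgN : ∀ x ∈ N, code (g (decode W x)) ∈ N := fun x hx =>
    hN.map_mem x hx _ (by simp [G]) (hcodeV _)
  have hubN : ∀ x ∈ N, code (ub (decode W x)) ∈ N := fun x hx =>
    hN.map_mem x hx _ (by simp [G]) (hcodeV _)
  have hDN : ∀ x ∈ N, ∀ m : ℕ, encode (D m (g (decode W x))) ∩ x ∈ N := fun x hx m =>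
    hN.map_mem x hx _ (by simp [G]) fun z hz =>
      hBV (encode_subset_univ _ (ZFSet.mem_inter.1 hz).1)
  have hbadN : ∀ x ∈ N, ∀ m : ℕ, encode (bad m (decode W x)) ∈ N := fun x hx m =>
    hN.map_mem x hx _ (by simp [G]) fun z hz => hBV (encode_subset_univ _ hz)
  clear_value G
  obtain ⟨γ, hγ⟩ := hbdd (decode W N) ((mk_decode_le N).trans hN.card_le)
  -- The coherence point of `a` is coded in `N`, hence lies below `γ`. So traces of `D m γ` on `a`
  -- eventually equal traces computed inside `N`.
  have hloc : ∀ a ∈ N, a.card ≤ ℵ₀ → ∃ k, ∀ m, k ≤ m → encode (D m γ) ∩ a ∈ N := by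
    intro a ha hac
    have hc : #(decode W a) ≤ ℵ₀ := (mk_decode_le a).trans hac
    obtain ⟨k, hk⟩ := hg (decode W a) hc γ (hγ _ (hgN a ha)).le
    refine ⟨k, fun m hm => ?_⟩
    have heq : encode (D m γ) ∩ a = encode (D m (g (decode W a))) ∩ a := by
      ext z
      simp only [ZFSet.mem_inter, mem_encode]
      have := hk m hm
      constructor
      · rintro ⟨⟨w, hw, rfl⟩, hz⟩
        exact ⟨⟨w, (this.subset ⟨hw, hz⟩).1, rfl⟩, hz⟩
      · rintro ⟨⟨w, hw, rfl⟩, hz⟩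
        exact ⟨⟨w, (this.superset ⟨hw, hz⟩).1, rfl⟩, hz⟩
    rw [heq]
    exact hDN a ha m
  -- If no threshold works for all `a`, cover a sequence of counterexamples by a countable element
  -- of `N`. The threshold for the union of its countable subsets of `B` serves for every
  -- counterexample.
  have hunif : ∃ k, ∀ a ∈ N, a.card ≤ ℵ₀ → ∀ m, k ≤ m → encode (D m γ) ∩ a ∈ N := by
    by_contra hcon
    push Not at hcon
    choose a haN hac m hm hbadm using hcon
    have haB : ∀ k, a k ∩ B ⊆ B := fun k z hz => (ZFSet.mem_inter.1 hz).2
    have haB' : ∀ k, (a k ∩ B).card ≤ ℵ₀ := fun k =>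
      (ZFSet.card_mono fun z hz => (ZFSet.mem_inter.1 hz).1).trans (hac k)
    obtain ⟨c, hc, hcc, hcov⟩ := hN.exists_countable_cover hPN hPV' hXV' (fun k => a k ∩ B)
      (fun k => hN.inter_mem _ (haN k) _ hBN) (fun k => hBX _ (haB k))
    obtain ⟨k, hk⟩ := hloc _ (hU c hc) (card_countableUnion_le B hcc)
    have h3 := hN.inter_mem _ (hk (m k) (hm k)) _ (hN.inter_mem _ (haN k) _ hBN)
    refine hbadm k ?_
    convert h3 using 1
    ext z
    simp only [ZFSet.mem_inter]
    constructor
    · rintro ⟨hz, hza⟩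
      have hzB := encode_subset_univ _ hz
      exact ⟨⟨hz, subset_countableUnion (hcov k) (haB k) (haB' k)
        (ZFSet.mem_inter.2 ⟨hza, hzB⟩)⟩, hza, hzB⟩
    · rintro ⟨⟨hz, -⟩, hza, -⟩
      exact ⟨hz, hza⟩
  obtain ⟨k, hk⟩ := hunif
  -- Otherwise each level `n ≥ k` is bounded in `N` by some `ξ n`. A countable cover of these has a
  -- strict upper bound coded in `N`, which lies below `γ` and so enters some level, a
  -- contradiction.
  have hcof : ∃ n, k ≤ n ∧ ∀ w : W, code w ∈ N → ∃ v ∈ D n γ, code v ∈ N ∧ w ≤ v := by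
    by_contra hcon
    push Not at hcon
    have hcon' : ∀ n : ℕ, ∃ w : W, code w ∈ N ∧
        (k ≤ n → ∀ v ∈ D n γ, code v ∈ N → v < w) := fun n => by
      by_cases hn : k ≤ n
      · obtain ⟨w, hw, h⟩ := hcon n hn
        exact ⟨w, hw, fun _ => h⟩
      · exact ⟨g (decode W B), hgN B hBN, fun h => absurd h hn⟩
    choose ξ hξN hξ using hcon'
    obtain ⟨c, hc, hcc, hcov⟩ := hN.exists_countable_cover hPN hPV' hXV' (fun n => code (ξ n)) hξN
      (fun n => ZFSet.mem_union.2 (Or.inl (code_mem_encode.2 (Set.mem_univ _))))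
    have hlt := hub (decode W c)
      (hbdd _ ((mk_decode_le c).trans (hcc.trans (aleph0_le_aleph 1))))
    obtain ⟨m, hm⟩ := hunion _ _ (hγ _ (hubN c hc))
    exact (hlt _ (hcov (max m k))).not_gt (hξ (max m k) (le_max_right _ _) _
      (hmono _ _ _ (le_max_left _ _) hm) (hubN c hc))
  obtain ⟨n, hkn, hn⟩ := hcof
  obtain ⟨E, hE, hxE⟩ := hN.guessing (encode (D n γ) ∩ N)
    (fun z hz => (ZFSet.mem_inter.1 hz).2)
    ⟨B, hBN, fun z hz => encode_subset_univ _ (ZFSet.mem_inter.1 hz).1⟩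
    (fun a ha haN hac => by
      have : encode (D n γ) ∩ N ∩ a = encode (D n γ) ∩ a := by
        ext z
        simp only [ZFSet.mem_inter]
        exact ⟨fun h => ⟨h.1.1, h.2⟩, fun h => ⟨⟨h.1, haN h.2⟩, h.2⟩⟩
      rw [this]
      exact hk a ha hac.le n hkn)
  have hiff : ∀ w : W, code w ∈ N → (code w ∈ E ↔ w ∈ D n γ) := fun w hw => by
    have : code w ∈ encode (D n γ) ∩ N ↔ code w ∈ N ∩ E := by rw [hxE]
    simp only [ZFSet.mem_inter, code_mem_encode, hw, and_true, true_and] at this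
    exact this.symm
  -- If `E` were bounded, a strict bound would be coded in `N`, against the cofinality of `D n γ ∩
  -- N`.
  have hunb : ∀ w, ∃ a ∈ decode W E, w ≤ a := by
    by_contra hcon
    push Not at hcon
    have hlt := hub (decode W E) hcon
    obtain ⟨v, hv, hvN, hle⟩ := hn _ (hubN E hE)
    exact (hlt v ((hiff v hvN).2 hv)).not_ge hle
  -- The countable subset of `E` chosen as uncovered at level `n` is coded in `N`, so its points are
  -- coded in `N`; there `E` agrees with `D n γ`, which therefore covers it.
  obtain ⟨hsub, hnot⟩ := hbad n _ hunb
  refine hnot γ fun w hw => ?_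
  have hwN : code w ∈ N := hN.subset_of_countable _ (hbadN E hE n)
    ((card_encode_le _).trans (hbadc n _)) (code_mem_encode.2 hw)
  exact (hiff w hwN).1 (hsub hw)

/-! ### Covering matrices and countable cofinality -/

theorem exists_rank_of_cof_eq_aleph0 {c : Cardinal.{u}} (hc : ℵ₀ ≤ c) (hcof : c.ord.cof = ℵ₀) :
    ∃ r : c.ord.ToType → ℕ, ∀ n, #{x | r x ≤ n} < c := by
  obtain ⟨s, hs, hsc⟩ := Order.exists_cof_eq c.ord.ToType
  rw [Ordinal.cof_toType, hcof] at hsc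
  have : Countable s := mk_le_aleph0_iff.1 hsc.le
  have : Nonempty s := mk_ne_zero_iff.1 (by rw [hsc]; exact aleph0_ne_zero)
  obtain ⟨f, hf⟩ := exists_surjective_nat s
  have hex : ∀ x : c.ord.ToType, ∃ n, x ≤ f n := fun x => by
    obtain ⟨y, hy, hxy⟩ := hs x
    obtain ⟨n, hn⟩ := hf ⟨y, hy⟩
    exact ⟨n, by rw [hn]; exact hxy⟩
  choose r hr using hex
  refine ⟨r, fun n => ?_⟩
  have hsub : {x | r x ≤ n} ⊆ ⋃ i ∈ Finset.range (n + 1), Set.Iic (f i : c.ord.ToType) := by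
    intro x hx
    simp only [Set.mem_iUnion]
    exact ⟨r x, Finset.mem_range.2 (Nat.lt_succ_of_le hx), hr x⟩
  refine (mk_le_mk_of_subset hsub).trans_lt ?_
  generalize Finset.range (n + 1) = t
  induction t using Finset.induction_on with
  | empty => simpa using aleph0_pos.trans_le hc
  | insert a t _ ih =>
    rw [Finset.set_biUnion_insert]
    refine (mk_union_le _ _).trans_lt (add_lt_of_lt hc ?_ ih)
    have := mk_Iic_lt (f a : c.ord.ToType) (by simp) (by simpa using hc)
    simpa using this

theorem exists_forall_lt_of_mk_le {c : Cardinal.{u}} (hc : ℵ₀ ≤ c)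
    {A : Set (Order.succ c).ord.ToType} (hA : #A ≤ c) : ∃ w, ∀ a ∈ A, a < w := by
  rw [← not_isCofinal_iff]
  intro hcof
  have := Order.cof_le hcof
  rw [Ordinal.cof_toType, (isRegular_succ hc).cof_ord] at this
  exact (Order.lt_succ c).not_ge (this.trans hA)

theorem mk_Iic_le_of_succ {c : Cardinal.{u}} (hc : ℵ₀ ≤ c) (w : (Order.succ c).ord.ToType) :
    #(Set.Iic w) ≤ c := by
  have := mk_Iic_lt w (by simp) (by simpa using hc.trans (Order.le_succ c))
  rw [mk_ord_toType] at this
  exact Order.lt_succ_iff.1 this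

/-- The covering matrix associated to level functions `l β`. -/
def matrix {W : Type u} [LT W] (l : W → W → ℕ) (n : ℕ) (β : W) : Set W :=
  {α | Relation.TransGen (fun α β => α < β ∧ l β α ≤ n) α β}

section matrix

variable {W : Type u} [LinearOrder W] {l : W → W → ℕ}

theorem matrix_mono {n m : ℕ} (h : n ≤ m) (β : W) : matrix l n β ⊆ matrix l m β := fun _ hα =>
  Relation.TransGen.mono (fun _ _ h' => ⟨h'.1, h'.2.trans h⟩) _ _ hα

theorem matrix_subset {n : ℕ} {α β : W} (h : α ∈ matrix l n β) : matrix l n α ⊆ matrix l n β :=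
  fun _ hα => Relation.TransGen.trans hα h

theorem mem_matrix {α β : W} (h : α < β) : α ∈ matrix l (l β α) β :=
  Relation.TransGen.single ⟨h, le_rfl⟩

/-- By induction on `β`: splitting off the last step of a chain writes `matrix l n β` as a union of
at most `c` sets of size at most `c`. -/
theorem mk_matrix_le [WellFoundedLT W] {n : ℕ} {c : Cardinal.{u}} (hc : ℵ₀ ≤ c)
    (hl : ∀ β, #{α | α < β ∧ l β α ≤ n} ≤ c) (β : W) : #(matrix l n β) ≤ c := by
  induction β using WellFoundedLT.induction with
  | _ β ih =>
    have hsub : matrix l n β ⊆ ⋃ α : {α | α < β ∧ l β α ≤ n}, insert α.1 (matrix l n α.1) := by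
      intro α hα
      rw [Set.mem_iUnion]
      cases hα with
      | single h => exact ⟨⟨α, h⟩, Set.mem_insert _ _⟩
      | tail h h' => exact ⟨⟨_, h'⟩, Set.mem_insert_of_mem _ h⟩
    refine (mk_le_mk_of_subset hsub).trans ((mk_iUnion_le_sum_mk).trans ?_)
    refine (sum_le_sum _ (fun _ => c) fun α => ?_).trans ?_
    · exact mk_insert_le.trans ((add_le_add (ih _ α.2.1) (one_le_aleph0.trans hc)).trans
        (add_eq_self hc).le)
    · rw [sum_const']
      exact (mul_le_mul_left (hl β) c).trans (mul_eq_self hc).le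

end matrix

/-- `ISP(ω₂)` implies the singular cardinal hypothesis at singular cardinals of countable
cofinality. -/
theorem power_aleph0_le_succ (h : ISP.{u} (ℵ_ 2)) {c : Cardinal.{u}} (hc : ℵ₀ ≤ c)
    (hcof : c.ord.cof = ℵ₀) (hpow : ∀ d < c, d ^ (ℵ₀ : Cardinal.{u}) < c) :
    c ^ (ℵ₀ : Cardinal.{u}) ≤ Order.succ c := by
  have h2 : (2 : Cardinal.{u}) ^ (ℵ₀ : Cardinal.{u}) < c :=
    hpow 2 ((natCast_lt_aleph0 (n := 2)).trans_le hc)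
  have h0 : ℵ₀ < c := (cantor _).trans h2
  have h1 : ℵ_ 1 ≤ c := by
    rw [← Order.succ_le_iff, ← aleph_zero, succ_aleph] at h0
    simpa using h0
  have hsc : ℵ₀ ≤ Order.succ c := hc.trans (Order.le_succ c)
  have hreg := isRegular_succ hc
  let W := (Order.succ c).ord.ToType
  have hW : #W = Order.succ c := mk_ord_toType _
  obtain ⟨r, hr⟩ := exists_rank_of_cof_eq_aleph0 hc hcof
  have hemb : ∀ β : W, Nonempty (Set.Iio β ↪ c.ord.ToType) := fun β => by
    rw [← le_def, mk_ord_toType]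
    exact (mk_le_mk_of_subset Set.Iio_subset_Iic_self).trans (mk_Iic_le_of_succ hc β)
  let e : ∀ β : W, Set.Iio β ↪ c.ord.ToType := fun β => (hemb β).some
  let l : W → W → ℕ := fun β α => if hαβ : α < β then r (e β ⟨α, hαβ⟩) else 0
  let D := matrix l
  let b : ℕ → Cardinal.{u} := fun n => max ℵ₀ #{x | r x ≤ n}
  have hb : ∀ n, b n < c := fun n => max_lt h0 (hr n)
  have hD : ∀ n β, #(D n β) ≤ b n := fun n β => by
    refine mk_matrix_le (le_max_left _ _) (fun β => le_trans ?_ (le_max_right _ _)) β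
    refine mk_le_of_injective (f := fun α => ⟨e β ⟨α.1, α.2.1⟩, ?_⟩) ?_
    · have := α.2.2
      simp only [l, dif_pos α.2.1] at this
      exact this
    · intro α α' hαα
      have := (e β).injective (congrArg Subtype.val hαα)
      exact Subtype.ext (Subtype.mk.inj this)
  have hcoh : ∀ A : Set W, #A ≤ ℵ₀ →
      ∃ γ, ∀ β, γ ≤ β → ∃ k, ∀ m, k ≤ m → D m β ∩ A = D m γ ∩ A := by
    intro A hA
    let f : W → ULift.{u} ℕ → Set A := fun β n => {a | a.1 ∈ D n.down β}
    have hcard : #(ULift.{u} ℕ → Set A) < (Order.succ c).ord.cof := by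
      rw [hreg.cof_ord]
      refine lt_of_le_of_lt ?_ (h2.trans (Order.lt_succ c))
      simp only [← power_def, mk_set, mk_uLift, mk_nat, lift_aleph0]
      rw [← power_mul]
      exact power_le_power_left two_ne_zero ((mul_le_mul_left hA _).trans aleph0_mul_aleph0.le)
    -- There are at most `2 ^ ℵ₀ < c⁺` sequences of traces on `A`, so one of them occurs for
    -- unboundedly many indices.
    obtain ⟨s, hs⟩ := infinite_pigeonhole_card f (Order.succ c) hW.ge hsc hcard
    have hunb : ∀ w, ∃ η ∈ f ⁻¹' {s}, w < η := fun w => by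
      by_contra hcon
      push Not at hcon
      have := hs.trans ((mk_le_mk_of_subset fun η hη => hcon η hη).trans (mk_Iic_le_of_succ hc w))
      exact (Order.lt_succ c).not_ge this
    have hne : Nonempty W := mk_ne_zero_iff.1 (by rw [hW]; exact (aleph0_pos.trans_le hsc).ne')
    obtain ⟨γ, hγ, -⟩ := hunb (Classical.arbitrary W)
    refine ⟨γ, fun β hβ => ?_⟩
    rcases hβ.eq_or_lt with rfl | hβ
    · exact ⟨0, fun _ _ => rfl⟩
    -- For large `m`, transitivity sandwiches `D m β` between `D m γ` and `D m η`, whose traces on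
    -- `A` coincide.
    obtain ⟨η, hη, hβη⟩ := hunb β
    refine ⟨max (l β γ) (l η β), fun m hm => ?_⟩
    have h3 : D m γ ⊆ D m β := matrix_subset (matrix_mono ((le_max_left _ _).trans hm) _
      (mem_matrix hβ))
    have h4 : D m β ⊆ D m η := matrix_subset (matrix_mono ((le_max_right _ _).trans hm) _
      (mem_matrix hβη))
    refine Set.Subset.antisymm ?_ (Set.inter_subset_inter_left _ h3)
    rintro a ⟨ha, haA⟩
    refine ⟨?_, haA⟩
    have h5 : f η = f γ := (Set.mem_singleton_iff.1 hη).trans (Set.mem_singleton_iff.1 hγ).symm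
    have h6 : (⟨a, haA⟩ : A) ∈ f η ⟨m⟩ := h4 ha
    rw [h5] at h6
    exact h6
  obtain ⟨n, A, hA, hcov⟩ := exists_unbounded_covered h (W := W)
    (fun A hA => exists_forall_lt_of_mk_le hc (hA.trans h1)) D
    (fun n m β hnm => matrix_mono hnm β) (fun α β hαβ => ⟨l β α, mem_matrix hαβ⟩) hcoh
  have hAc : c ≤ #A := by
    have := Order.cof_le (s := A) hA
    rw [Ordinal.cof_toType, hreg.cof_ord] at this
    exact (Order.le_succ c).trans this
  have hcov' : ∀ f : ULift.{u} ℕ → A, ∃ β, ∀ i, (f i).1 ∈ D n β := fun f => by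
    obtain ⟨β, hβ⟩ := hcov (Set.range fun i => (f i).1) (by rintro _ ⟨i, rfl⟩; exact (f i).2)
      (mk_range_le.trans (by simp))
    exact ⟨β, fun i => hβ ⟨i, rfl⟩⟩
  choose β hβ using hcov'
  calc c ^ (ℵ₀ : Cardinal.{u}) ≤ #A ^ (ℵ₀ : Cardinal.{u}) := power_le_power_right hAc
    _ = #(ULift.{u} ℕ → A) := by simp
    _ ≤ #(Σ β : W, (ULift.{u} ℕ → D n β)) := by
      refine mk_le_of_injective (f := fun f => ⟨β f, fun i => ⟨(f i).1, hβ f i⟩⟩) ?_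
      intro f f' hff
      rw [Sigma.mk.injEq] at hff
      obtain ⟨h3, h4⟩ := hff
      have h5 : ∀ (γ δ : W) (x : ULift.{u} ℕ → D n γ) (y : ULift.{u} ℕ → D n δ), γ = δ →
          HEq x y → ∀ i, (x i).1 = (y i).1 := by
        rintro γ _ x y rfl hxy i
        rw [eq_of_heq hxy]
      exact funext fun i => Subtype.ext (h5 _ _ _ _ h3 h4 i)
    _ ≤ Order.succ c := by
      rw [mk_sigma]
      refine (sum_le_sum _ (fun _ => c) fun β => ?_).trans ?_
      · simp only [← power_def, mk_uLift, mk_nat, lift_aleph0]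
        exact (power_le_power_right (hD n β)).trans (hpow _ (hb n)).le
      · rw [sum_const', hW]
        exact (mul_le_mul_right (Order.le_succ c) _).trans (mul_eq_self hsc).le

/-! ### Fat sets and Silver's theorem -/

/-- `S` is fat if every regressive function on `S` is bounded on an unbounded subset of `S`. -/
def Fat {I : Type u} [LinearOrder I] (S : Set I) : Prop :=
  ∀ g : I → I, (∀ α ∈ S, ¬ IsMin α → g α < α) → ∃ β, ∀ γ, ∃ α ∈ S, γ ≤ α ∧ g α ≤ β

section Fat

variable {I : Type u} [LinearOrder I]

/-- A weak pressing-down lemma. If `g` were not bounded on any unbounded set, an `ω`-sequence could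
be built closing off its escape points, and at its supremum `g` could not be regressive. -/
theorem fat_univ [WellFoundedLT I] [Nonempty I] (hI : ∀ s : ℕ → I, ∃ b, ∀ n, s n < b) :
    Fat (Set.univ : Set I) := by
  intro g hg
  by_contra hcon
  push Not at hcon
  choose c hc using hcon
  have hnext : ∀ x : I, ∃ y, c x ≤ y ∧ x < y := fun x => by
    obtain ⟨y, hy⟩ := hI fun _ => max x (c x)
    exact ⟨y, (le_max_right _ _).trans (hy 0).le, (le_max_left _ _).trans_lt (hy 0)⟩
  choose nx hnx hnx' using hnext
  let a : ℕ → I := fun n => nx^[n] (Classical.arbitrary I)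
  have ha : ∀ n, a (n + 1) = nx (a n) := fun n => Function.iterate_succ_apply' _ _ _
  let B : Set I := {b | ∀ n, a n < b}
  have hB : B.Nonempty := hI a
  let b := WellFounded.min (wellFounded_lt (α := I)) B hB
  have hb : ∀ n, a n < b := WellFounded.min_mem (wellFounded_lt (α := I)) B hB
  have hgb : g b < b := hg b (Set.mem_univ b) fun h => (hb 0).not_ge (h (hb 0).le)
  have hex : ∃ n, g b ≤ a n := by
    by_contra hno
    push Not at hno
    exact WellFounded.not_lt_min (wellFounded_lt (α := I)) B hno hgb
  obtain ⟨n, hn⟩ := hex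
  refine (hc (a n) b (Set.mem_univ b) ?_).not_ge hn
  exact (hnx (a n)).trans ((ha n).symm.le.trans (hb (n + 1)).le)

theorem Fat.of_union {S T : Set I} (h : Fat (S ∪ T)) : Fat S ∨ Fat T := by
  classical
  by_contra hcon
  rw [not_or] at hcon
  obtain ⟨hS, hT⟩ := hcon
  unfold Fat at hS hT
  push Not at hS hT
  obtain ⟨g, hg, hg'⟩ := hS
  obtain ⟨f, hf, hf'⟩ := hT
  obtain ⟨β, hβ⟩ := h (fun α => if α ∈ S then g α else f α) fun α hα hmin => by
    by_cases hαS : α ∈ S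
    · simpa [hαS] using hg α hαS hmin
    · simpa [hαS] using hf α (hα.resolve_left hαS) hmin
  obtain ⟨γ, hγ⟩ := hg' β
  obtain ⟨δ, hδ⟩ := hf' β
  obtain ⟨α, hα, hle, hαβ⟩ := hβ (max γ δ)
  by_cases hαS : α ∈ S
  · simp only [hαS, if_true] at hαβ
    exact (hγ α hαS ((le_max_left _ _).trans hle)).not_ge hαβ
  · simp only [hαS, if_false] at hαβ
    exact (hδ α (hα.resolve_left hαS) ((le_max_right _ _).trans hle)).not_ge hαβ

/-- A family of almost disjoint functions, each regressive on a fat set, is small. -/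
theorem mk_le_of_fat (hI : ∀ s : ℕ → I, ∃ b, ∀ n, s n < b) {O F : Type u} [LinearOrder O]
    {p : I → O} (hp : Monotone p) {c : Cardinal.{u}} (hc : ℵ₀ ≤ c) (hIc : #I ≤ c)
    (hpow : ∀ β, (#(Set.Iio (p β)) + 1) ^ #I ≤ c) (S : F → Set I) (hS : ∀ f, Fat (S f))
    (v : F → I → O) (hv : ∀ f, ∀ α ∈ S f, ¬ IsMin α → ∃ β < α, v f α < p β)
    (hinj : ∀ f f', (∀ γ, ∃ α, γ ≤ α ∧ α ∈ S f ∧ α ∈ S f' ∧ v f α = v f' α) → f = f') :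
    #F ≤ c := by
  classical
  have hex : ∀ f α, ∃ β, α ∈ S f → ¬ IsMin α → β < α ∧ v f α < p β := fun f α => by
    by_cases h : α ∈ S f ∧ ¬ IsMin α
    · obtain ⟨β, h1, h2⟩ := hv f α h.1 h.2
      exact ⟨β, fun _ _ => ⟨h1, h2⟩⟩
    · exact ⟨α, fun h1 h2 => absurd ⟨h1, h2⟩ h⟩
  choose g hg using hex
  have hfat := fun f => hS f (g f) fun α hα hmin => (hg f α hα hmin).1
  choose b hb using hfat
  have hb' : ∀ f γ, ∃ α ∈ S f, γ ≤ α ∧ v f α < p (b f) := fun f γ => by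
    -- Going strictly above `γ` ensures that `α` is not minimal, as regressivity requires.
    obtain ⟨δ, hδ⟩ := hI fun _ => γ
    obtain ⟨α, hα, hle, hαb⟩ := hb f δ
    have hlt := (hδ 0).trans_le hle
    exact ⟨α, hα, hlt.le, (hg f α hα fun h => hlt.not_ge (h hlt.le)).2.trans_le (hp hαb)⟩
  -- Each `f` is recorded by its bound and the part of `v f` below it. This part has unbounded
  -- domain, so almost disjointness makes the record injective.
  let φ : F → Σ β : I, (I → Option (Set.Iio (p β))) := fun f =>
    ⟨b f, fun α => if h : α ∈ S f ∧ v f α < p (b f) then some ⟨v f α, h.2⟩ else none⟩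
  have hφ : Function.Injective φ := by
    intro f f' hff
    have key : ∀ (β β' : I) (x : I → Option (Set.Iio (p β))) (y : I → Option (Set.Iio (p β'))),
        (⟨β, x⟩ : Σ β : I, (I → Option (Set.Iio (p β)))) = ⟨β', y⟩ →
          ∀ α, (x α).map Subtype.val = (y α).map Subtype.val := by
      intro β β' x y hxy α
      cases hxy
      rfl
    have key' := key _ _ _ _ hff
    refine hinj f f' fun γ => ?_
    obtain ⟨α, hα, hle, hlt⟩ := hb' f γ
    have h1 := key' α
    rw [dif_pos ⟨hα, hlt⟩] at h1
    by_cases h2 : α ∈ S f' ∧ v f' α < p (b f')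
    · rw [dif_pos h2] at h1
      exact ⟨α, hle, hα, h2.1, by simpa using h1⟩
    · rw [dif_neg h2] at h1
      simp at h1
  refine (mk_le_of_injective hφ).trans ?_
  rw [mk_sigma]
  refine (sum_le_sum _ (fun _ => c) fun β => ?_).trans ?_
  · simpa using hpow β
  · rw [sum_const']
    exact (mul_le_mul_left hIc c).trans (mul_eq_self hc).le

end Fat

/-- If `A` were larger, some point would not be a predecessor of any of `c⁺` chosen points; by
totality all of these would be its predecessors. -/
theorem mk_le_succ_of_total {A : Type u} {c : Cardinal.{u}} (hc : ℵ₀ ≤ c) (R : A → A → Prop)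
    (htot : ∀ x y, R x y ∨ R y x) (hR : ∀ y, #{x | R x y} ≤ c) : #A ≤ Order.succ c := by
  by_contra hlt
  rw [not_le] at hlt
  obtain ⟨G, hG⟩ := le_mk_iff_exists_set.1 hlt.le
  have hU : #(⋃ y : G, {x | R x y}) ≤ Order.succ c := by
    refine mk_iUnion_le_sum_mk.trans ((sum_le_sum _ (fun _ => Order.succ c) fun y : G =>
      (hR y.1).trans (Order.le_succ c)).trans ?_)
    rw [sum_const', hG, mul_eq_self (hc.trans (Order.le_succ c))]
  have hex : ∃ x, x ∉ ⋃ y : G, {x | R x y} := by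
    by_contra hno
    push Not at hno
    rw [Set.eq_univ_of_forall hno, mk_univ] at hU
    exact hU.not_gt hlt
  obtain ⟨x, hx⟩ := hex
  simp only [Set.mem_iUnion, not_exists] at hx
  have hsub : G ⊆ {y | R y x} := fun y hy => (htot x y).resolve_left (hx ⟨y, hy⟩)
  exact (Order.lt_succ c).not_ge (hG.ge.trans ((mk_le_mk_of_subset hsub).trans (hR x)))

theorem exists_total_of_mk_le_succ {A : Type u} {c : Cardinal.{u}} (hc : ℵ₀ ≤ c)
    (hA : #A ≤ Order.succ c) :
    ∃ R : A → A → Prop, (∀ x y, R x y ∨ R y x) ∧ ∀ y, #{x | R x y} ≤ c := by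
  rw [← mk_ord_toType (Order.succ c), le_def] at hA
  obtain ⟨j⟩ := hA
  refine ⟨fun x y => j x ≤ j y, fun x y => le_total _ _, fun y => ?_⟩
  refine (mk_le_of_injective (f := fun x : {x | j x ≤ j y} => (⟨j x.1, x.2⟩ : Set.Iic (j y))) ?_).trans
    (mk_Iic_le_of_succ hc _)
  intro x x' h
  exact Subtype.ext (j.injective (Subtype.mk.inj h))

theorem exists_le_mk_Iio {c d : Cardinal.{u}} (h : d < c) :
    ∃ x : c.ord.ToType, d ≤ #(Set.Iio x) := by
  have h1 : Ordinal.type (α := d.ord.ToType) (· < ·) < Ordinal.type (α := c.ord.ToType) (· < ·) := by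
    simpa using h
  obtain ⟨f⟩ := Ordinal.type_lt_iff.1 h1
  refine ⟨f.top, ?_⟩
  conv_lhs => rw [← mk_ord_toType d]
  refine mk_le_of_injective (f := fun x => ⟨f x, f.lt_top x⟩) fun x y hxy => ?_
  exact f.injective (Subtype.mk.inj hxy)

/-- Silver's theorem: the bound `c ^ k ≤ c⁺` at a cardinal of uncountable cofinality at most `k`
follows from the same bounds below. -/
theorem power_le_succ_of_uncountable_cof {c k : Cardinal.{u}} (hc : ℵ₀ ≤ c) (hk : ℵ₀ ≤ k)
    (hcof : ℵ₀ < c.ord.cof) (hcofk : c.ord.cof ≤ k) (hpow : ∀ d < c, d ^ k < c)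
    (hsucc : ∀ d < c, 2 ^ k ≤ d → d ^ k ≤ Order.succ d) : c ^ k ≤ Order.succ c := by
  classical
  have h2 : (2 : Cardinal.{u}) ^ k < c := hpow 2 ((natCast_lt_aleph0 (n := 2)).trans_le hc)
  have hkc : k < c := (cantor k).trans h2
  have h2k : ℵ₀ ≤ (2 : Cardinal.{u}) ^ k := hk.trans (cantor k).le
  let O := c.ord.ToType
  have hOc : #O = c := mk_ord_toType c
  obtain ⟨s, hs, hsc⟩ := Order.exists_cof_eq O
  rw [Ordinal.cof_toType] at hsc
  obtain ⟨x₀, hx₀⟩ := exists_le_mk_Iio h2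
  have hOne : Nonempty O := ⟨x₀⟩
  -- Starting at `x₀` makes every nontrivial `K α` have size at least `2 ^ k`, so that `hsucc`
  -- applies.
  let I : Set O := {x ∈ s | x₀ ≤ x}
  have hIcof : IsCofinal I := fun x => by
    obtain ⟨y, hy, hxy⟩ := hs (max x x₀)
    exact ⟨y, ⟨hy, (le_max_right _ _).trans hxy⟩, (le_max_left _ _).trans hxy⟩
  have hIk : #I ≤ k := (mk_le_mk_of_subset fun x hx => hx.1).trans (hsc.le.trans hcofk)
  have hI : ∀ s : ℕ → I, ∃ b, ∀ n, s n < b := fun s => by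
    have hnc : ¬ IsCofinal (Set.range s) := fun h => by
      have h3 := Order.cof_le h
      rw [Order.cof_eq_of_isCofinal hIcof, Ordinal.cof_toType] at h3
      exact hcof.not_ge (h3.trans (by simpa using (mk_range_le_lift (f := s))))
    obtain ⟨b, hb⟩ := not_isCofinal_iff.1 hnc
    exact ⟨b, fun n => hb _ ⟨n, rfl⟩⟩
  have hIne : Nonempty I := by
    obtain ⟨y, hy, -⟩ := hIcof x₀
    exact ⟨⟨y, hy⟩⟩
  have hIio : ∀ x : O, #(Set.Iio x) < c := fun x => by
    have := mk_Iio_lt x (by simp [O])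
    rwa [hOc] at this
  -- Taking the union over `β < α` ensures that every member of `K α` lies below some earlier point,
  -- so functions with values in `K α` are regressive.
  let K : I → Set O := fun α => {ζ | ∃ β : I, β < α ∧ ζ < β.1}
  have hKlt : ∀ α, #(K α) < c := fun α => by
    refine (mk_le_mk_of_subset ?_).trans_lt (hIio α.1)
    rintro ζ ⟨β, hβ, hζ⟩
    exact hζ.trans hβ
  have hKge : ∀ α, ¬ IsMin α → 2 ^ k ≤ #(K α) := fun α hα => by
    rw [not_isMin_iff] at hα
    obtain ⟨β, hβ⟩ := hα
    exact hx₀.trans (mk_le_mk_of_subset fun ζ hζ => ⟨β, hβ, lt_of_lt_of_le hζ β.2.2⟩)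
  let T := k.ord.ToType
  have hT : #T = k := mk_ord_toType k
  let A : I → Type u := fun α => T → Option (K α)
  let tr : (T → O) → ∀ α, A α := fun h α t => if ht : h t ∈ K α then some ⟨h t, ht⟩ else none
  have hr : ∀ α, ∃ R : A α → A α → Prop, (∀ x y, R x y ∨ R y x) ∧
      (¬ IsMin α → ∀ y, #{x | R x y} ≤ #(K α)) := fun α => by
    by_cases hα : IsMin α
    · exact ⟨fun _ _ => True, fun _ _ => Or.inl trivial, fun h => absurd hα h⟩
    · have hK := hKge α hα
      have hK0 := h2k.trans hK
      have hA : #(A α) ≤ Order.succ #(K α) := by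
        have : #(A α) = #(K α) ^ k := by
          simp [A, hT, add_eq_left hK0 (one_le_aleph0.trans hK0)]
        rw [this]
        exact hsucc _ (hKlt α) hK
      obtain ⟨R, h3, h4⟩ := exists_total_of_mk_le_succ hK0 hA
      exact ⟨R, h3, fun _ => h4⟩
  choose r hrtot hrle using hr
  have hH : #(T → O) = c ^ k := by simp [hT, hOc]
  rw [← hH]
  -- Functions are compared through their truncations on a fat set of indices. Totality holds
  -- because one of two sets covering `I` is fat.
  refine mk_le_succ_of_total hc (fun g f => Fat {α | r α (tr g α) (tr f α)}) ?_ ?_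
  · intro g f
    refine Fat.of_union ?_
    have : {α | r α (tr g α) (tr f α)} ∪ {α | r α (tr f α) (tr g α)} = Set.univ :=
      Set.eq_univ_of_forall fun α => hrtot α _ _
    rw [this]
    exact fat_univ hI
  · intro f
    -- Inject the predecessors of the truncation of `f` into `K α`. The predecessors of `f` then
    -- become an almost disjoint family of regressive functions.
    have hj : ∀ α, ∃ j : A α → O, ¬ IsMin α → Set.InjOn j {x | r α x (tr f α)} ∧
        ∀ x, r α x (tr f α) → j x ∈ K α := fun α => by
      by_cases hα : IsMin α
      · exact ⟨fun _ => x₀, fun h => absurd hα h⟩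
      · have := hrle α hα (tr f α)
        rw [le_def] at this
        obtain ⟨e⟩ := this
        refine ⟨fun x => if hx : r α x (tr f α) then (e ⟨x, hx⟩).1 else x₀, fun _ => ⟨?_, ?_⟩⟩
        · intro x hx y hy hxy
          have hx' : r α x (tr f α) := hx
          have hy' : r α y (tr f α) := hy
          simp only [dif_pos hx', dif_pos hy'] at hxy
          exact Subtype.mk.inj (e.injective (Subtype.ext hxy))
        · intro x hx
          simp only [dif_pos hx]
          exact (e ⟨x, hx⟩).2
    choose j hj using hj
    refine mk_le_of_fat hI (p := fun β : I => β.1) (fun _ _ h => h) hc (hIk.trans hkc.le) ?_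
      (fun g : {g | Fat {α | r α (tr g α) (tr f α)}} => {α | r α (tr g.1 α) (tr f α)})
      (fun g => g.2) (fun g α => j α (tr g.1 α)) ?_ ?_
    · intro β
      refine (power_le_power_left ?_ hIk).trans (hpow _ (add_lt_of_lt hc (hIio β.1)
        (one_lt_aleph0.trans_le hc))).le
      simp
    · intro g α hα hmin
      obtain ⟨β, hβ, hlt⟩ := (hj α hmin).2 _ hα
      exact ⟨β, hβ, hlt⟩
    · intro g g' hgg
      refine Subtype.ext (funext fun t => ?_)
      obtain ⟨b, hb, hb'⟩ := hIcof (max (g.1 t) (g'.1 t))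
      obtain ⟨b₁, hb₁⟩ := hI fun _ => ⟨b, hb⟩
      obtain ⟨b₂, hb₂⟩ := hI fun _ => b₁
      obtain ⟨α, hle, h3, h4, h5⟩ := hgg b₂
      have hlt : b₁ < α := (hb₂ 0).trans_le hle
      have h6 := (hj α fun h => hlt.not_ge (h hlt.le)).1 h3 h4 h5
      have h7 := congrFun h6 t
      have hg : g.1 t ∈ K α := ⟨b₁, hlt, ((le_max_left _ _).trans hb').trans_lt (hb₁ 0)⟩
      have hg' : g'.1 t ∈ K α := ⟨b₁, hlt, ((le_max_right _ _).trans hb').trans_lt (hb₁ 0)⟩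
      simp only [tr, dif_pos hg, dif_pos hg', Option.some.injEq, Subtype.mk.injEq] at h7
      exact h7

/-! ### Induction on the base -/

/-- A function into `c` is determined by its truncations at a cofinal set of points, and each point
admits fewer than `c` truncations. -/
theorem power_le_power_cof {c k : Cardinal.{u}} (hc : ℵ₀ ≤ c) (hpow : ∀ d < c, d ^ k < c) :
    c ^ k ≤ c ^ c.ord.cof := by
  classical
  let O := c.ord.ToType
  have hOc : #O = c := mk_ord_toType c
  obtain ⟨I, hI, hIc⟩ := Order.exists_cof_eq O
  rw [Ordinal.cof_toType] at hIc
  have hIio : ∀ x : O, #(Set.Iic x) < c := fun x => by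
    have := mk_Iic_lt x (by simp [O]) (by rwa [hOc])
    rwa [hOc] at this
  let T := k.ord.ToType
  have hT : #T = k := mk_ord_toType k
  have hH : #(T → O) = c ^ k := by simp [hT, hOc]
  let φ : (T → O) → ∀ i : I, (T → Option (Set.Iic i.1)) := fun h i t =>
    if ht : h t ≤ i.1 then some ⟨h t, ht⟩ else none
  have hφ : Function.Injective φ := by
    intro g g' hgg
    funext t
    obtain ⟨b, hb, hb'⟩ := hI (max (g t) (g' t))
    have h7 := congrFun (congrFun hgg ⟨b, hb⟩) t
    have h1 := (le_max_left _ _).trans hb'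
    have h2 := (le_max_right _ _).trans hb'
    simp only [φ, dif_pos h1, dif_pos h2, Option.some.injEq] at h7
    exact congrArg Subtype.val h7
  rw [← hH]
  refine (mk_le_of_injective hφ).trans ?_
  rw [mk_pi, ← hIc, ← prod_const']
  refine prod_le_prod _ _ fun i => ?_
  have : #(T → Option (Set.Iic i.1)) = (#(Set.Iic i.1) + 1) ^ k := by simp [hT]
  rw [this]
  exact (hpow _ (add_lt_of_lt hc (hIio i.1) (one_lt_aleph0.trans_le hc))).le

/-- Every function from `k` to `c` is bounded, so it suffices to sum `d ^ k` over the initial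
segments. -/
theorem power_le_self_of_lt_cof {c k : Cardinal.{u}} (hc : ℵ₀ ≤ c) (hk : k < c.ord.cof)
    (hpow : ∀ d < c, d ^ k < c) : c ^ k ≤ c := by
  let O := c.ord.ToType
  have hOc : #O = c := mk_ord_toType c
  let T := k.ord.ToType
  have hT : #T = k := mk_ord_toType k
  have hH : #(T → O) = c ^ k := by simp [hT, hOc]
  have hbd : ∀ f : T → O, ∃ b, ∀ t, f t < b := fun f => by
    have hnc : ¬ IsCofinal (Set.range f) := fun h => by
      have h3 := Order.cof_le h
      rw [Ordinal.cof_toType] at h3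
      exact hk.not_ge (h3.trans (mk_range_le.trans hT.le))
    obtain ⟨b, hb⟩ := not_isCofinal_iff.1 hnc
    exact ⟨b, fun n => hb _ ⟨n, rfl⟩⟩
  choose b hb using hbd
  rw [← hH]
  have hinj : Function.Injective
      (fun f => ⟨b f, fun t => ⟨f t, hb f t⟩⟩ : (T → O) → Σ x : O, (T → Set.Iio x)) := by
    intro f f' hff
    have key : ∀ (β β' : O) (x : T → Set.Iio β) (y : T → Set.Iio β'),
        (⟨β, x⟩ : Σ x : O, (T → Set.Iio x)) = ⟨β', y⟩ → ∀ t, (x t).1 = (y t).1 := by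
      intro β β' x y hxy t
      cases hxy
      rfl
    exact funext (key _ _ _ _ hff)
  refine (mk_le_of_injective hinj).trans ?_
  rw [mk_sigma]
  refine (sum_le_sum _ (fun _ => c) fun x => ?_).trans ?_
  · have := mk_Iio_lt x (by simp [O])
    rw [hOc] at this
    simpa [hT] using (hpow _ this).le
  · rw [sum_const', hOc, mul_eq_self hc]

theorem power_le_succ (h : ISP.{u} (ℵ_ 2)) {k : Cardinal.{u}} (hk : ℵ₀ ≤ k) (c : Cardinal.{u}) :
    2 ^ k ≤ c → c ^ k ≤ Order.succ c := by
  induction c using WellFoundedLT.induction with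
  | _ c ih =>
    intro h2
    have hc : ℵ₀ ≤ c := hk.trans ((cantor k).le.trans h2)
    by_cases hpow : ∀ d < c, d ^ k < c
    · rcases lt_or_ge k c.ord.cof with hlt | hle
      · exact (power_le_self_of_lt_cof hc hlt hpow).trans (Order.le_succ c)
      · have hcof : ℵ₀ ≤ c.ord.cof := Ordinal.aleph0_le_cof_iff.2
          (Ordinal.one_lt_cof_iff.2 (isSuccLimit_ord hc))
        rcases hcof.eq_or_lt with heq | hlt
        · refine (power_le_power_cof hc hpow).trans ?_
          rw [← heq]
          refine power_aleph0_le_succ h hc heq.symm fun d hd => ?_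
          rcases eq_or_ne d 0 with rfl | hd0
          · rw [zero_power aleph0_ne_zero]
            exact aleph0_pos.trans_le hc
          · exact (power_le_power_left hd0 hk).trans_lt (hpow d hd)
        · exact power_le_succ_of_uncountable_cof hc hk hlt hle hpow fun d hd => ih d hd
    · push Not at hpow
      obtain ⟨d, hd, hcd⟩ := hpow
      rcases h2.eq_or_lt with heq | hlt
      · rw [← heq, ← power_mul, mul_eq_self hk]
        exact Order.le_succ _
      · have hD : max d (2 ^ k) < c := max_lt hd hlt
        have h3 := ih _ hD (le_max_right _ _)
        calc c ^ k ≤ (max d (2 ^ k) ^ k) ^ k :=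
              power_le_power_right (hcd.trans (power_le_power_right (le_max_left _ _)))
          _ = max d (2 ^ k) ^ k := by rw [← power_mul, mul_eq_self hk]
          _ ≤ Order.succ (max d (2 ^ k)) := h3
          _ ≤ c := Order.succ_le_of_lt hD
          _ ≤ Order.succ c := Order.le_succ c

end GuessingModels

theorem corollary1p6 (h : GuessingModels.ISP.{u} (ℵ_ 2)) : GuessingModels.SCH.{u} := by
  intro μ hμ h2
  have hcof : ℵ₀ ≤ μ.ord.cof := Ordinal.aleph0_le_cof_iff.2
          (Ordinal.one_lt_cof_iff.2 (isSuccLimit_ord hμ.aleph0_le))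
  exact (GuessingModels.power_le_succ h hcof μ h2.le).antisymm
    (Order.succ_le_of_lt (lt_power_cof_ord hμ.aleph0_le))
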